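/- Let $H$ be a complex Hilbert space, let $Q$ be a unitary operator on $H$, and let $T_1,T_2$ be contractions on $H$ (that is, bounded operators with $\|T_i\|\le 1$) forming a $Q$-commuting pair, i.e. satisfying one of the three relations \[ \text{(a)}\ \ T_1T_2=Q\,T_2T_1,\qquad \text{(b)}\ \ T_1T_2=T_2\,Q\,T_1,\qquad \text{(c)}\ \ T_1T_2=T_2T_1\,Q . \] Then there exist a Hilbert space $K\supset H$ (that is, a complex Hilbert space $K$ containing $H$ isometrically as a closed subspace) and unitary operators $U_1,U_2,\widetilde Q$ on $K$ such that 1. $(U_1,U_2)$ is a $\widetilde Q$-commuting pair through the relation of the same form: $U_1U_2=\widetilde Q\,U_2U_1$ in case (a), $U_1U_2=U_2\,\widetilde Q\,U_1$ in case (b), and $U_1U_2=U_2U_1\,\widetilde Q$ in case (c); 2. $T_1^{k_1}T_2^{k_2}=P_H\,U_1^{k_1}U_2^{k_2}|_H$ for all integers $k_1,k_2\ge 0$, where $P_H$ is the orthogonal projection of $K$ onto $H$; 3. $H$ is a reducing subspace for $\widetilde Q$ (invariant under $\widetilde Q$ and $\widetilde Q^*$) and $\widetilde Q|_H=Q$.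 -/

import Mathlib

universe u

/-- The three forms of `Q`-commutation of an ordered pair of operators. -/
inductive QRelation : Type
  /-- the relation `A B = Q B A` -/
  | left
  /-- the relation `A B = B Q A` -/
  | middle
  /-- the relation `A B = B A Q` -/
  | right

/-- `r.Holds Q A B`: the pair `(A, B)` of bounded operators is `Q`-commuting through the
relation of form `r`. The product of operators is composition. -/
def QRelation.Holds {E : Type*} [NormedAddCommGroup E] [InnerProductSpace ℂ E]
    (r : QRelation) (Q A B : E →L[ℂ] E) : Prop :=
  match r with
  | .left => A * B = Q * B * A
  | .middle => A * B = B * Q * A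
  | .right => A * B = B * A * Q

/-- A subspace reduces `A` if it is invariant under both `A` and its adjoint. -/
def IsReducingSubspace {E : Type*} [NormedAddCommGroup E] [InnerProductSpace ℂ E]
    [CompleteSpace E] (M : Submodule ℂ E) (A : E →L[ℂ] E) : Prop :=
  (∀ x ∈ M, A x ∈ M) ∧ ∀ x ∈ M, ContinuousLinearMap.adjoint A x ∈ M

/-- The range of a linear isometry out of a complete space is complete, so that the orthogonal
projection onto it exists. -/
instance completeSpace_range_linearIsometry {E F : Type*}
    [NormedAddCommGroup E] [InnerProductSpace ℂ E] [CompleteSpace E]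
    [NormedAddCommGroup F] [InnerProductSpace ℂ F] (J : E →ₗᵢ[ℂ] F) :
    CompleteSpace J.range :=
  (J.isometry.isUniformInducing.isComplete_range).completeSpace_coe

noncomputable section

open ContinuousLinearMap

/-! This is Ando's argument with `Q` inserted, for the form `T₁ T₂ = T₂ T₁ Q`. Each contraction
lifts to an isometry of `H ⊕ ℓ²` storing its defect `D h` in a half shift. After two lifts, a full
shift, the two products differ only in coordinate zero: `(D₁ T₂ h, D₂ h)` against `(D₂ T₁ Q h, D₁ Q
h)`. These have equal norms since `Q` is isometric, so a unitary `G` matches them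
(`exists_unitary_map_of_norm_eq`); twisting by `G` coordinatewise gives `V₁ V₂ = V₂ V₁ (Q ⊕ 1)`
(`exists_isometric_lift`).

The isometries are then extended to unitaries independently of each other: `Q'` is defined as their
multiplicative commutator, which automatically extends `Q ⊕ 1` (`exists_unitary_extension_pair`).
The other two forms reduce to this one. -/

theorem WithLp.ext_fst_snd {α β : Type*} {x y : WithLp 2 (α × β)} (h₁ : x.fst = y.fst)
    (h₂ : x.snd = y.snd) : x = y :=
  WithLp.ofLp_injective 2 (Prod.ext h₁ h₂)

/-! ### Unitary extensions and defect operators -/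

section Extension

variable {E F : Type*} [NormedAddCommGroup E] [InnerProductSpace ℂ E] [CompleteSpace E]
  [NormedAddCommGroup F] [InnerProductSpace ℂ F] [CompleteSpace F]

/-- A partial isometry `C` is the compression of a unitary operator on `F ⊕ F`, whose first column
is `(C, 1 - C† C)`. -/
theorem exists_unitary_extending_partial_isometry (C : F →L[ℂ] F) (hC : C * star C * C = C) :
    ∃ U : WithLp 2 (F × F) ≃ₗᵢ[ℂ] WithLp 2 (F × F),
      ∀ x, U (WithLp.toLp 2 (x, 0)) = WithLp.toLp 2 (C x, x - star C (C x)) := by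
  have hC' : star C * C * star C = star C := by
    simpa [mul_assoc] using congrArg star hC
  have h1 (x : F) : C (star C (C x)) = C x := congrArg (fun A : F →L[ℂ] F => A x) hC
  have h2 (x : F) : star C (C (star C x)) = star C x :=
    congrArg (fun A : F →L[ℂ] F => A x) hC'
  have hadj (x y : F) : inner ℂ (C x) y = inner ℂ x (star C y) :=
    (adjoint_inner_right C x y).symm
  have hadj' (x y : F) : inner ℂ (star C x) y = inner ℂ x (C y) :=
    adjoint_inner_left C y x
  -- The block matrix with rows `(C, 1 - C C†)` and `(1 - C† C, C†)`. Exchanging `C` and `C†` gives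
  -- `W`, which is both its inverse and its adjoint.
  let U : WithLp 2 (F × F) →ₗ[ℂ] WithLp 2 (F × F) :=
    { toFun := fun z => WithLp.toLp 2
        (C z.fst + (z.snd - C (star C z.snd)), z.fst - star C (C z.fst) + star C z.snd)
      map_add' := fun x y => by
        refine WithLp.ext_fst_snd ?_ ?_ <;> simp <;> abel
      map_smul' := fun c x => by
        refine WithLp.ext_fst_snd ?_ ?_ <;> simp [smul_sub] }
  let W : WithLp 2 (F × F) →ₗ[ℂ] WithLp 2 (F × F) :=
    { toFun := fun z => WithLp.toLp 2
        (star C z.fst + (z.snd - star C (C z.snd)), z.fst - C (star C z.fst) + C z.snd)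
      map_add' := fun x y => by
        refine WithLp.ext_fst_snd ?_ ?_ <;> simp <;> abel
      map_smul' := fun c x => by
        refine WithLp.ext_fst_snd ?_ ?_ <;> simp [smul_sub] }
  have hUW (z) : U (W z) = z := by
    refine WithLp.ext_fst_snd ?_ ?_ <;> simp [U, W, h1, h2]
  have hWU (z) : W (U z) = z := by
    refine WithLp.ext_fst_snd ?_ ?_ <;> simp [U, W, h1, h2]
  have hin (x y) : inner ℂ (U x) y = inner ℂ x (W y) := by
    simp [U, W, inner_add_left, inner_sub_left, inner_add_right, inner_sub_right, hadj, hadj']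
    ring
  refine ⟨⟨LinearEquiv.ofLinearMap U W (LinearMap.ext hUW) (LinearMap.ext hWU), fun x => ?_⟩,
    fun x => ?_⟩
  · have : inner ℂ (U x) (U x) = inner ℂ x x := by rw [hin, hWU]
    rw [← sq_eq_sq₀ (norm_nonneg _) (norm_nonneg _)]
    rw [inner_self_eq_norm_sq_to_K, inner_self_eq_norm_sq_to_K] at this
    exact_mod_cast this
  · refine WithLp.ext_fst_snd ?_ ?_ <;> simp [U]

/-- An isometry of `E` extends to a unitary operator on `E ⊕ E`. -/
theorem LinearIsometry.exists_unitary_extension (V : E →ₗᵢ[ℂ] E) :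
    ∃ U : WithLp 2 (E × E) ≃ₗᵢ[ℂ] WithLp 2 (E × E),
      ∀ x, U (WithLp.toLp 2 (x, 0)) = WithLp.toLp 2 (V x, 0) := by
  have hV : star V.toContinuousLinearMap * V.toContinuousLinearMap = 1 :=
    (norm_map_iff_adjoint_comp_self _).1 V.norm_map
  obtain ⟨U, hU⟩ := exists_unitary_extending_partial_isometry V.toContinuousLinearMap
    (by rw [mul_assoc, hV, mul_one])
  refine ⟨U, fun x => ?_⟩
  have := congrArg (fun A : E →L[ℂ] E => A x) hV
  simp only [mul_apply_eq_comp, one_apply_eq_self] at this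
  rw [hU, this, sub_self]
  rfl

omit [CompleteSpace E] in
/-- If `‖A x‖ = ‖B x‖` for all `x`, then some unitary operator on `F ⊕ F` maps each `(A x, 0)` to
`(B x, 0)`. -/
theorem exists_unitary_map_of_norm_eq (A B : E →L[ℂ] F) (h : ∀ x, ‖A x‖ = ‖B x‖) :
    ∃ G : WithLp 2 (F × F) ≃ₗᵢ[ℂ] WithLp 2 (F × F),
      ∀ x, G (WithLp.toLp 2 (A x, 0)) = WithLp.toLp 2 (B x, 0) := by
  let M : Submodule ℂ F := (LinearMap.range A.toLinearMap).topologicalClosure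
  have : CompleteSpace M := (Submodule.isClosed_topologicalClosure _).completeSpace_coe
  let e : E →ₗ[ℂ] M := A.toLinearMap.codRestrict M fun x =>
    Submodule.le_topologicalClosure _ (LinearMap.mem_range_self _ x)
  have he : DenseRange e := by
    intro y
    rw [Topology.IsInducing.subtypeVal.closure_eq_preimage_closure_image]
    have : Subtype.val '' Set.range e = (LinearMap.range A.toLinearMap : Set F) := by
      rw [← Set.range_comp]; rfl
    have hy : (y : F) ∈ closure (LinearMap.range A.toLinearMap : Set F) := y.2
    rw [← this] at hy
    exact hy
  have hn (x : E) : ‖B.toLinearMap x‖ ≤ 1 * ‖e x‖ := by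
    rw [one_mul]; exact (h x).ge
  -- Equality of norms makes `A x ↦ B x` well defined and isometric on the range of `A`, hence on
  -- its closure `M`. Composing with the projection onto `M` gives a partial isometry `C`; its
  -- defect `1 - C† C` vanishes on `M`.
  let v : M →L[ℂ] F := B.toLinearMap.extendOfNorm e
  have hv (x : E) : v (e x) = B x := LinearMap.extendOfNorm_eq he ⟨1, hn⟩ x
  have hviso (y : M) : ‖v y‖ = ‖y‖ := by
    refine he.induction_on (p := fun y => ‖v y‖ = ‖y‖) y
      (isClosed_eq (by fun_prop) (by fun_prop)) fun x => ?_
    rw [hv]; exact (h x).symm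
  have hvv : adjoint v ∘L v = 1 := (norm_map_iff_adjoint_comp_self v).1 hviso
  have hvv' (y : M) : adjoint v (v y) = y := congrArg (fun T : M →L[ℂ] M => T y) hvv
  let C : F →L[ℂ] F := v ∘L M.orthogonalProjectionOnto
  have hstar : star C = M.subtypeL ∘L adjoint v := by
    rw [star_eq_adjoint, adjoint_comp, Submodule.adjoint_orthogonalProjectionOnto]
  have hCs (x : F) : star C (C x) = M.orthogonalProjectionOnto x := by
    rw [hstar]; simp [C, hvv']
  have hCA (x : E) : C (A x) = B x := by
    have : M.orthogonalProjectionOnto (A x) = e x :=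
      Submodule.orthogonalProjectionOnto_mem_subspace_eq_self (e x)
    simp [C, this, hv]
  obtain ⟨G, hG⟩ := exists_unitary_extending_partial_isometry C (by
    ext x
    rw [mul_assoc]
    simp only [mul_apply_eq_comp, hCs]
    exact congrArg v (Submodule.orthogonalProjectionOnto_mem_subspace_eq_self _))
  refine ⟨G, fun x => ?_⟩
  have : M.orthogonalProjectionOnto (A x) = e x :=
    Submodule.orthogonalProjectionOnto_mem_subspace_eq_self (e x)
  rw [hG, hCs, hCA, this]
  congr 2
  exact sub_self _

/-- A contraction has a defect operator. -/
theorem exists_defect_operator (T : E →L[ℂ] E) (hT : ‖T‖ ≤ 1) :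
    ∃ D : E →L[ℂ] E, ∀ x, ‖T x‖ ^ 2 + ‖D x‖ ^ 2 = ‖x‖ ^ 2 := by
  have hpos : 0 ≤ 1 - star T * T := by
    rw [sub_nonneg, ← CStarAlgebra.norm_le_one_iff_of_nonneg (star T * T) (star_mul_self_nonneg T),
      CStarRing.norm_star_mul_self]
    exact mul_le_one₀ hT (norm_nonneg _) hT
  obtain ⟨D, hD⟩ := CStarAlgebra.nonneg_iff_eq_star_mul_self.1 hpos
  refine ⟨D, fun x => ?_⟩
  have key (S : E →L[ℂ] E) : inner ℂ x ((star S * S) x) = (‖S x‖ ^ 2 : ℂ) := by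
    rw [mul_apply_eq_comp, star_eq_adjoint, adjoint_inner_right, inner_self_eq_norm_sq_to_K]
    rfl
  have h := key D
  rw [← hD, sub_apply, inner_sub_right, key T, one_apply_eq_self, inner_self_eq_norm_sq_to_K] at h
  have h' : ‖x‖ ^ 2 - ‖T x‖ ^ 2 = ‖D x‖ ^ 2 := by
    apply Complex.ofReal_injective
    push_cast
    exact h
  linarith

end Extension

/-! ### The half shift on square-summable sequences -/

section SequenceSpace

variable {M Y H : Type*} [NormedAddCommGroup M] [InnerProductSpace ℂ M]
  [NormedAddCommGroup Y] [InnerProductSpace ℂ Y]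
  [NormedAddCommGroup H] [InnerProductSpace ℂ H]

omit [InnerProductSpace ℂ Y] in
theorem lp.hasSum_norm_sq (f : lp (fun _ : ℕ => Y) 2) :
    HasSum (fun n => ‖f n‖ ^ 2) (‖f‖ ^ 2) := by
  simpa using lp.hasSum_norm (p := 2) (by norm_num) f

/-- The isometry into `ℓ²` with prescribed coordinates. -/
def lpIsometryOfCoordinates (φ : M →ₗ[ℂ] ℕ → Y)
    (h : ∀ x, HasSum (fun n => ‖φ x n‖ ^ 2) (‖x‖ ^ 2)) : M →ₗᵢ[ℂ] lp (fun _ : ℕ => Y) 2 where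
  toFun x := ⟨φ x, memℓp_gen (by simpa using (h x).summable)⟩
  map_add' x y := by ext n; simp; rfl
  map_smul' c x := by ext n; simp
  norm_map' x := by
    rw [← sq_eq_sq₀ (norm_nonneg _) (norm_nonneg _)]
    exact (lp.hasSum_norm_sq _).unique (h x)

/-- The isometry of `ℓ²` acting as `g` in every coordinate. -/
def lpMapIsometry (g : Y →ₗᵢ[ℂ] Y) : lp (fun _ : ℕ => Y) 2 →ₗᵢ[ℂ] lp (fun _ : ℕ => Y) 2 :=
  lpIsometryOfCoordinates
    { toFun := fun f n => g (f n)
      map_add' := fun x y => by ext n; simp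
      map_smul' := fun c x => by ext n; simp }
    fun x => by simpa using lp.hasSum_norm_sq x

@[simp]
theorem lpMapIsometry_apply (g : Y →ₗᵢ[ℂ] Y) (f : lp (fun _ : ℕ => Y) 2) (n : ℕ) :
    lpMapIsometry g f n = g (f n) := rfl

/-- The coefficient space `(H ⊕ H) ⊕ (H ⊕ H)` of the isometric lift. -/
abbrev LiftCoeff (H : Type*) : Type _ := WithLp 2 (WithLp 2 (H × H) × WithLp 2 (H × H))

/-- The square-summable sequences in `LiftCoeff H`. -/
abbrev LiftSeq (H : Type*) [NormedAddCommGroup H] : Type _ := lp (fun _ : ℕ => LiftCoeff H) 2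

/-- The pair carried over into the coordinate `n` by the half shift. -/
def halfShiftCarry (z : WithLp 2 (H × LiftSeq H)) : ℕ → WithLp 2 (H × H)
  | 0 => WithLp.toLp 2 (z.fst, 0)
  | n + 1 => WithLp.toLp 2 ((z.snd n).fst.snd, (z.snd n).snd.snd)

/-- The half shift: each coordinate `((a, b), (c, d))` is split into `(a, c)` and `(b, d)`; the
first pair moves to the second half of its coordinate, the second one to the first half of the
next coordinate, and the vector of `H` fills the first slot. -/
def halfShift : WithLp 2 (H × LiftSeq H) →ₗᵢ[ℂ] LiftSeq H :=
  lpIsometryOfCoordinates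
    { toFun := fun z n => WithLp.toLp 2
        (WithLp.toLp 2 ((halfShiftCarry z n).fst, (z.snd n).fst.fst),
          WithLp.toLp 2 ((halfShiftCarry z n).snd, (z.snd n).snd.fst))
      map_add' := fun x y => by
        funext n
        cases n <;> refine WithLp.ext_fst_snd (WithLp.ext_fst_snd ?_ ?_) (WithLp.ext_fst_snd ?_ ?_)
          <;> simp [halfShiftCarry]
      map_smul' := fun c x => by
        funext n
        cases n <;> refine WithLp.ext_fst_snd (WithLp.ext_fst_snd ?_ ?_) (WithLp.ext_fst_snd ?_ ?_)
          <;> simp [halfShiftCarry] }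
    fun z => by
      have h₀ := lp.hasSum_norm_sq z.snd
      simp only [WithLp.prod_norm_sq_eq_of_L2] at h₀ ⊢
      have hs₁ : Summable fun n => ‖(z.snd n).fst.fst‖ ^ 2 + ‖(z.snd n).snd.fst‖ ^ 2 :=
        h₀.summable.of_nonneg_of_le (fun n => by positivity) fun n => by
          nlinarith [sq_nonneg ‖(z.snd n).fst.snd‖, sq_nonneg ‖(z.snd n).snd.snd‖]
      have hs₂ : Summable fun n => ‖(z.snd n).fst.snd‖ ^ 2 + ‖(z.snd n).snd.snd‖ ^ 2 :=
        h₀.summable.of_nonneg_of_le (fun n => by positivity) fun n => by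
          nlinarith [sq_nonneg ‖(z.snd n).fst.fst‖, sq_nonneg ‖(z.snd n).snd.fst‖]
      obtain ⟨s₁, hs₁⟩ := hs₁
      obtain ⟨s₂, hs₂⟩ := hs₂
      have hcarry : HasSum
          (fun n => ‖(halfShiftCarry z n).fst‖ ^ 2 + ‖(halfShiftCarry z n).snd‖ ^ 2)
          (‖z.fst‖ ^ 2 + s₂) := by
        rw [← hasSum_nat_add_iff' 1]
        simpa [halfShiftCarry] using hs₂
      have hsum : ‖z.snd‖ ^ 2 = s₁ + s₂ := h₀.unique ((hs₁.add hs₂).congr_fun fun n => by ring)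
      rw [hsum]
      convert hcarry.add hs₁ using 1
      · funext n
        exact add_add_add_comm _ _ _ _
      · ring

/-- Two half shifts make one full shift: the two inserted vectors fill exactly the first half of
coordinate zero, the form of vector on which `G` is prescribed. -/
theorem halfShift_halfShift_zero (a b : H) (e : LiftSeq H) :
    halfShift (WithLp.toLp 2 (a, halfShift (WithLp.toLp 2 (b, e)))) 0 =
      WithLp.toLp 2 (WithLp.toLp 2 (a, b), 0) := rfl

theorem halfShift_halfShift_succ (a b : H) (e : LiftSeq H) (n : ℕ) :
    halfShift (WithLp.toLp 2 (a, halfShift (WithLp.toLp 2 (b, e)))) (n + 1) = e n := by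
  cases n <;> rfl

end SequenceSpace

/-! ### Ando's isometric lift -/

section Lift

variable {H : Type*} [NormedAddCommGroup H] [InnerProductSpace ℂ H]

/-- The isometry `(h, e) ↦ (T h, S (D h, e))` of `H ⊕ ℓ²`, where `S` is the half shift and `D` is a
defect operator of `T`. -/
def shiftLift (T D : H →L[ℂ] H) (hD : ∀ x, ‖T x‖ ^ 2 + ‖D x‖ ^ 2 = ‖x‖ ^ 2) :
    WithLp 2 (H × LiftSeq H) →ₗᵢ[ℂ] WithLp 2 (H × LiftSeq H) where
  toFun z := WithLp.toLp 2 (T z.fst, halfShift (WithLp.toLp 2 (D z.fst, z.snd)))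
  map_add' x y := by
    refine WithLp.ext_fst_snd ?_ ?_
    · simp
    · simp only [WithLp.add_fst, WithLp.add_snd, map_add]
      exact map_add halfShift (WithLp.toLp 2 (D x.fst, x.snd)) (WithLp.toLp 2 (D y.fst, y.snd))
  map_smul' c x := by
    refine WithLp.ext_fst_snd ?_ ?_
    · simp
    · simp only [WithLp.smul_fst, WithLp.smul_snd, map_smul]
      exact map_smul halfShift c (WithLp.toLp 2 (D x.fst, x.snd))
  norm_map' z := by
    rw [← sq_eq_sq₀ (norm_nonneg _) (norm_nonneg _), WithLp.prod_norm_sq_eq_of_L2 z, ← hD z.fst]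
    have h := halfShift.norm_map (WithLp.toLp 2 (D z.fst, z.snd))
    simp only [WithLp.prod_norm_sq_eq_of_L2] at h ⊢
    change ‖T z.fst‖ ^ 2 + ‖halfShift (WithLp.toLp 2 (D z.fst, z.snd))‖ ^ 2 = _
    rw [h, WithLp.prod_norm_sq_eq_of_L2]
    simp
    ring

/-- Ando's construction: a pair of contractions with `T₁ T₂ = T₂ T₁ Q` lifts to a pair of
isometries of `H ⊕ ℓ²` with `V₁ V₂ = V₂ V₁ (Q ⊕ 1)`. -/
theorem exists_isometric_lift [CompleteSpace H] (Q : H ≃ₗᵢ[ℂ] H) (T₁ T₂ : H →L[ℂ] H)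
    (hT₁ : ‖T₁‖ ≤ 1) (hT₂ : ‖T₂‖ ≤ 1) (h : ∀ x, T₁ (T₂ x) = T₂ (T₁ (Q x))) :
    ∃ V₁ V₂ : WithLp 2 (H × LiftSeq H) →ₗᵢ[ℂ] WithLp 2 (H × LiftSeq H),
      (∀ z, (V₁ z).fst = T₁ z.fst) ∧ (∀ z, (V₂ z).fst = T₂ z.fst) ∧
      ∀ z, V₁ (V₂ z) = V₂ (V₁ (WithLp.toLp 2 (Q z.fst, z.snd))) := by
  obtain ⟨D₁, hD₁⟩ := exists_defect_operator T₁ hT₁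
  obtain ⟨D₂, hD₂⟩ := exists_defect_operator T₂ hT₂
  -- `A` and `B` give the defects that the two products of lifts store in coordinate zero. Both
  -- squared norms equal `‖x‖² - ‖T₁ T₂ x‖²`, by telescoping.
  let A : H →L[ℂ] WithLp 2 (H × H) :=
    (WithLp.prodContinuousLinearEquiv 2 ℂ H H).symm ∘L (D₁ ∘L T₂).prod D₂
  let Q₀ : H →L[ℂ] H := Q
  let B : H →L[ℂ] WithLp 2 (H × H) :=
    (WithLp.prodContinuousLinearEquiv 2 ℂ H H).symm ∘L
      (D₂ ∘L T₁ ∘L Q₀).prod (D₁ ∘L Q₀)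
  obtain ⟨G, hG⟩ := exists_unitary_map_of_norm_eq A B fun x => by
    rw [← sq_eq_sq₀ (norm_nonneg _) (norm_nonneg _)]
    simp only [WithLp.prod_norm_sq_eq_of_L2]
    change ‖D₁ (T₂ x)‖ ^ 2 + ‖D₂ x‖ ^ 2 = ‖D₂ (T₁ (Q x))‖ ^ 2 + ‖D₁ (Q x)‖ ^ 2
    have h₁ := hD₁ (T₂ x)
    have h₂ := hD₂ x
    have h₃ := hD₂ (T₁ (Q x))
    have h₄ := hD₁ (Q x)
    rw [Q.norm_map] at h₄
    rw [h x] at h₁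
    linarith
  let g := lpMapIsometry G.toLinearIsometry
  let g' := lpMapIsometry G.symm.toLinearIsometry
  have hgg' (e) : g (g' e) = e := by ext n : 2; simp [g, g']
  have hg'g (e) : g' (g e) = e := by ext n : 2; simp [g, g']
  let id' : H →ₗᵢ[ℂ] H := LinearIsometry.id
  -- With `g` after the first lift and `g'` before the second, the twists cancel inside `V₂ V₁`. In
  -- `V₁ V₂` they surround a full shift: they cancel in the later coordinates and leave `G` in
  -- coordinate zero.
  refine ⟨(id'.withLpProdMap 2 g).comp (shiftLift T₁ D₁ hD₁),
    (shiftLift T₂ D₂ hD₂).comp (id'.withLpProdMap 2 g'), fun z => rfl, fun z => rfl, fun z => ?_⟩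
  refine WithLp.ext_fst_snd (h z.fst) ?_
  change g (halfShift (WithLp.toLp 2 (D₁ (T₂ z.fst),
    halfShift (WithLp.toLp 2 (D₂ z.fst, g' z.snd))))) =
    halfShift (WithLp.toLp 2 (D₂ (T₁ (Q z.fst)), g' (g
      (halfShift (WithLp.toLp 2 (D₁ (Q z.fst), z.snd))))))
  rw [hg'g]
  ext n : 2
  cases n with
  | zero =>
    rw [lpMapIsometry_apply, halfShift_halfShift_zero, halfShift_halfShift_zero]
    exact hG z.fst
  | succ n =>
    rw [lpMapIsometry_apply, halfShift_halfShift_succ, halfShift_halfShift_succ]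
    simp [g']

end Lift

/-! ### Unitary dilations for the three relations -/

section Dilation

variable {H : Type u} [NormedAddCommGroup H] [InnerProductSpace ℂ H] [CompleteSpace H]

theorem LinearIsometry.starProjection_range_apply {K : Type*} [NormedAddCommGroup K]
    [InnerProductSpace ℂ K] [CompleteSpace K] (J : H →ₗᵢ[ℂ] K) (y : K) :
    J.range.starProjection y = J (adjoint J.toContinuousLinearMap y) := by
  refine Submodule.eq_starProjection_of_mem_of_inner_eq_zero ⟨_, rfl⟩ ?_
  rintro _ ⟨x, rfl⟩
  have h : inner ℂ (J (adjoint J.toContinuousLinearMap y)) (J x) = inner ℂ y (J x) := by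
    rw [J.inner_map_map]
    exact adjoint_inner_left J.toContinuousLinearMap x y
  rw [inner_sub_left]
  exact sub_eq_zero.2 h.symm

/-- The isometric embedding of the first summand. -/
def inlIsometry (E F : Type*) [NormedAddCommGroup E] [InnerProductSpace ℂ E]
    [NormedAddCommGroup F] [InnerProductSpace ℂ F] : E →ₗᵢ[ℂ] WithLp 2 (E × F) where
  toFun x := WithLp.toLp 2 (x, 0)
  map_add' x y := by refine WithLp.ext_fst_snd ?_ ?_ <;> simp
  map_smul' c x := by refine WithLp.ext_fst_snd ?_ ?_ <;> simp
  norm_map' x := WithLp.norm_toLp_fst 2 _ _ x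

omit [CompleteSpace H] in
-- The second coordinate of `w` is left open, because compression to `H` discards it.
theorem exists_pow_apply_eq_of_lift {E K : Type*} [NormedAddCommGroup E] [NormedAddCommGroup K]
    [InnerProductSpace ℂ K] {T : H →L[ℂ] H} {V : WithLp 2 (H × E) → WithLp 2 (H × E)}
    {U : K →L[ℂ] K} {ι : WithLp 2 (H × E) → K} (hT : ∀ z, (V z).fst = T z.fst)
    (hU : ∀ z, U (ι z) = ι (V z)) (k : ℕ) (z : WithLp 2 (H × E)) :
    ∃ w, (U ^ k) (ι z) = ι w ∧ w.fst = (T ^ k) z.fst := by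
  induction k with
  | zero => exact ⟨z, rfl, rfl⟩
  | succ k ih =>
    obtain ⟨w, hw, hw'⟩ := ih
    refine ⟨V w, ?_, ?_⟩
    · rw [pow_succ', mul_apply_eq_comp, hw, hU]
    · rw [pow_succ', mul_apply_eq_comp, hT, hw']

/-- Operators extending lifts of `T₁` and `T₂` to `H ⊕ E` dilate the products
`T₁ ^ k₁ * T₂ ^ k₂`. -/
theorem pow_mul_pow_eq_compression_of_lift {E K : Type*} [NormedAddCommGroup E]
    [InnerProductSpace ℂ E] [CompleteSpace E] [NormedAddCommGroup K] [InnerProductSpace ℂ K]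
    [CompleteSpace K] {T₁ T₂ : H →L[ℂ] H} {V₁ V₂ : WithLp 2 (H × E) → WithLp 2 (H × E)}
    {U₁ U₂ : K →L[ℂ] K} (ι : WithLp 2 (H × E) →ₗᵢ[ℂ] K)
    (h₁ : ∀ z, (V₁ z).fst = T₁ z.fst) (h₂ : ∀ z, (V₂ z).fst = T₂ z.fst)
    (hU₁ : ∀ z, U₁ (ι z) = ι (V₁ z)) (hU₂ : ∀ z, U₂ (ι z) = ι (V₂ z)) (k₁ k₂ : ℕ) :
    T₁ ^ k₁ * T₂ ^ k₂ = adjoint (ι.comp (inlIsometry H E)).toContinuousLinearMap ∘L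
      (U₁ ^ k₁ * U₂ ^ k₂) ∘L (ι.comp (inlIsometry H E)).toContinuousLinearMap := by
  have hadj (z : WithLp 2 (H × E)) :
      adjoint (ι.comp (inlIsometry H E)).toContinuousLinearMap (ι z) = z.fst := by
    refine ext_inner_right ℂ fun x => ?_
    rw [adjoint_inner_left]
    change inner ℂ (ι z) (ι (inlIsometry H E x)) = _
    rw [ι.inner_map_map]
    simp [inlIsometry]
  ext x
  obtain ⟨w, hw, hw'⟩ := exists_pow_apply_eq_of_lift h₂ hU₂ k₂ (inlIsometry H E x)
  obtain ⟨y, hy, hy'⟩ := exists_pow_apply_eq_of_lift h₁ hU₁ k₁ w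
  change (T₁ ^ k₁) ((T₂ ^ k₂) x) = adjoint (ι.comp (inlIsometry H E)).toContinuousLinearMap
    ((U₁ ^ k₁) ((U₂ ^ k₂) (ι (inlIsometry H E x))))
  rw [hw, hy, hadj, hy', hw']
  rfl

/-- A `Q`-commuting unitary dilation of `(T₁, T₂)` with `Q` extended to a unitary operator. -/
def HasQCommutingDilation (r : QRelation) (Q T₁ T₂ : H →L[ℂ] H) : Prop :=
  ∃ (K : Type u) (_ : NormedAddCommGroup K) (_ : InnerProductSpace ℂ K)
    (_ : CompleteSpace K) (J : H →ₗᵢ[ℂ] K) (U₁ U₂ Q' : unitary (K →L[ℂ] K)),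
    r.Holds (Q' : K →L[ℂ] K) U₁ U₂ ∧
    (∀ k₁ k₂ : ℕ, T₁ ^ k₁ * T₂ ^ k₂ = adjoint J.toContinuousLinearMap ∘L
      ((U₁ : K →L[ℂ] K) ^ k₁ * (U₂ : K →L[ℂ] K) ^ k₂) ∘L J.toContinuousLinearMap) ∧
    ∀ h : H, (Q' : K →L[ℂ] K) (J h) = J (Q h)

variable {Q T₁ T₂ : H →L[ℂ] H}

theorem unitary_apply_star_apply {E : Type*} [NormedAddCommGroup E] [InnerProductSpace ℂ E]
    [CompleteSpace E] (U : unitary (E →L[ℂ] E)) (x : E) :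
    (U : E →L[ℂ] E) ((star U).1 x) = x :=
  congrArg (fun A : E →L[ℂ] E => A x) (Unitary.mul_star_self_of_mem U.2)

theorem unitary_star_apply_apply {E : Type*} [NormedAddCommGroup E] [InnerProductSpace ℂ E]
    [CompleteSpace E] (U : unitary (E →L[ℂ] E)) (x : E) :
    (star U).1 ((U : E →L[ℂ] E) x) = x :=
  congrArg (fun A : E →L[ℂ] E => A x) (Unitary.star_mul_self_of_mem U.2)

/-- As `Q` is onto, `Q'` maps the copy of `H` onto itself; this is what makes it reducing rather
than merely invariant. -/
theorem star_unitary_intertwines {K : Type*} [NormedAddCommGroup K] [InnerProductSpace ℂ K]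
    [CompleteSpace K] {J : H →ₗᵢ[ℂ] K} {Q' : unitary (K →L[ℂ] K)} {Q : unitary (H →L[ℂ] H)}
    (h : ∀ x, (Q' : K →L[ℂ] K) (J x) = J ((Q : H →L[ℂ] H) x)) (x : H) :
    (star Q').1 (J x) =
      J ((star Q).1 x) := by
  rw [← unitary_star_apply_apply Q' (J ((star Q).1 x)), h, unitary_apply_star_apply]

/-- Two isometries of `E` with `V₁ V₂ = V₂ V₁ q` extend to unitary operators on `E ⊕ E`, whose
multiplicative commutator then extends `q`. -/
theorem exists_unitary_extension_pair {E : Type*} [NormedAddCommGroup E] [InnerProductSpace ℂ E]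
    [CompleteSpace E] (V₁ V₂ : E →ₗᵢ[ℂ] E) (q : E → E)
    (hV : ∀ z, V₁ (V₂ z) = V₂ (V₁ (q z))) :
    ∃ U₁ U₂ Q' : unitary (WithLp 2 (E × E) →L[ℂ] WithLp 2 (E × E)),
      (∀ z, U₁.1 (inlIsometry E E z) = inlIsometry E E (V₁ z)) ∧
      (∀ z, U₂.1 (inlIsometry E E z) = inlIsometry E E (V₂ z)) ∧
      U₁ * U₂ = U₂ * U₁ * Q' ∧
      ∀ z, Q'.1 (inlIsometry E E z) = inlIsometry E E (q z) := by
  obtain ⟨W₁, hW₁⟩ := V₁.exists_unitary_extension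
  obtain ⟨W₂, hW₂⟩ := V₂.exists_unitary_extension
  obtain ⟨U₁, hU₁⟩ : ∃ U₁ : unitary (WithLp 2 (E × E) →L[ℂ] WithLp 2 (E × E)),
      ∀ z, U₁.1 (inlIsometry E E z) = inlIsometry E E (V₁ z) :=
    ⟨Unitary.linearIsometryEquiv.symm W₁, hW₁⟩
  obtain ⟨U₂, hU₂⟩ : ∃ U₂ : unitary (WithLp 2 (E × E) →L[ℂ] WithLp 2 (E × E)),
      ∀ z, U₂.1 (inlIsometry E E z) = inlIsometry E E (V₂ z) :=
    ⟨Unitary.linearIsometryEquiv.symm W₂, hW₂⟩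
  refine ⟨U₁, U₂, star (U₂ * U₁) * (U₁ * U₂), hU₁, hU₂, ?_, fun z => ?_⟩
  · rw [← mul_assoc (U₂ * U₁), Unitary.mul_star_self, one_mul]
  · have h : (U₁ * U₂).1 (inlIsometry E E z) = (U₂ * U₁).1 (inlIsometry E E (q z)) := by
      change U₁.1 (U₂.1 _) = U₂.1 (U₁.1 _)
      rw [hU₂, hU₁, hU₁, hU₂, hV]
    change (star (U₂ * U₁)).1 ((U₁ * U₂).1 _) = _
    rw [h, unitary_star_apply_apply]

/-- A pair of contractions with `T₁ T₂ = T₂ T₁ Q` lifts to isometries of `H ⊕ ℓ²` which extend to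
unitary operators with `U₁ U₂ = U₂ U₁ Q'`, where `Q'` extends `Q ⊕ 1`. -/
theorem exists_unitary_extension_of_lift (Q : unitary (H →L[ℂ] H))
    (hT₁ : ‖T₁‖ ≤ 1) (hT₂ : ‖T₂‖ ≤ 1) (h : T₁ * T₂ = T₂ * T₁ * Q) :
    ∃ (K : Type u) (_ : NormedAddCommGroup K) (_ : InnerProductSpace ℂ K)
      (_ : CompleteSpace K) (ι : WithLp 2 (H × LiftSeq H) →ₗᵢ[ℂ] K)
      (V₁ V₂ : WithLp 2 (H × LiftSeq H) → WithLp 2 (H × LiftSeq H))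
      (U₁ U₂ Q' : unitary (K →L[ℂ] K)),
      (∀ z, (V₁ z).fst = T₁ z.fst) ∧ (∀ z, (V₂ z).fst = T₂ z.fst) ∧
      (∀ z, (U₁ : K →L[ℂ] K) (ι z) = ι (V₁ z)) ∧ (∀ z, (U₂ : K →L[ℂ] K) (ι z) = ι (V₂ z)) ∧
      U₁ * U₂ = U₂ * U₁ * Q' ∧
      ∀ z, (Q' : K →L[ℂ] K) (ι z) = ι (WithLp.toLp 2 ((Q : H →L[ℂ] H) z.fst, z.snd)) := by
  obtain ⟨V₁, V₂, h₁, h₂, hV⟩ := exists_isometric_lift (Unitary.linearIsometryEquiv Q)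
    T₁ T₂ hT₁ hT₂ fun x => congrArg (fun A : H →L[ℂ] H => A x) h
  obtain ⟨U₁, U₂, Q', hU₁, hU₂, hU, hQ'⟩ := exists_unitary_extension_pair V₁ V₂ _ hV
  exact ⟨_, inferInstance, inferInstance, inferInstance, inlIsometry _ _, V₁, V₂, U₁, U₂, Q',
    h₁, h₂, hU₁, hU₂, hU, hQ'⟩

theorem hasQCommutingDilation_right (hQ : Q ∈ unitary (H →L[ℂ] H))
    (hT₁ : ‖T₁‖ ≤ 1) (hT₂ : ‖T₂‖ ≤ 1) (h : T₁ * T₂ = T₂ * T₁ * Q) :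
    HasQCommutingDilation .right Q T₁ T₂ := by
  obtain ⟨K, _, _, _, ι, V₁, V₂, U₁, U₂, Q', h₁, h₂, hU₁, hU₂, hU, hQ'⟩ :=
    exists_unitary_extension_of_lift ⟨Q, hQ⟩ hT₁ hT₂ h
  exact ⟨K, inferInstance, inferInstance, inferInstance, ι.comp (inlIsometry _ _), U₁, U₂, Q',
    congrArg Subtype.val hU, pow_mul_pow_eq_compression_of_lift ι h₁ h₂ hU₁ hU₂,
    fun x => hQ' (inlIsometry _ _ x)⟩

/-- `Q` is absorbed into the second operator: `T₁ (T₂ Q) = (T₂ Q) T₁ Q`. Since `Q'` acts as `Q ⊕ 1`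
on the whole lift space, `U₂ Q'†` still extends a lift, now of `T₂ Q Q† = T₂`. -/
theorem hasQCommutingDilation_middle (hQ : Q ∈ unitary (H →L[ℂ] H))
    (hT₁ : ‖T₁‖ ≤ 1) (hT₂ : ‖T₂‖ ≤ 1) (h : T₁ * T₂ = T₂ * Q * T₁) :
    HasQCommutingDilation .middle Q T₁ T₂ := by
  let q : unitary (H →L[ℂ] H) := ⟨Q, hQ⟩
  have hS : ‖T₂ * Q‖ ≤ 1 := by rwa [CStarRing.norm_mul_coe_unitary T₂ q]
  obtain ⟨K, _, _, _, ι, V₁, V₂, U₁, U₂, Q', h₁, h₂, hU₁, hU₂, hU, hQ'⟩ :=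
    exists_unitary_extension_of_lift (T₁ := T₁) (T₂ := T₂ * Q) q hT₁ hS (by
      rw [← mul_assoc, h])
  let W (z : WithLp 2 (H × LiftSeq H)) : WithLp 2 (H × LiftSeq H) :=
    V₂ (WithLp.toLp 2 ((star q).1 z.fst, z.snd))
  have hQs (z) : (star Q').1 (ι z) = ι (WithLp.toLp 2 ((star q).1 z.fst, z.snd)) := by
    have hz : Q'.1 (ι (WithLp.toLp 2 ((star q).1 z.fst, z.snd))) = ι z := by
      rw [hQ']
      exact congrArg ι (WithLp.ext_fst_snd (unitary_apply_star_apply q z.fst) rfl)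
    rw [← hz, unitary_star_apply_apply]
  refine ⟨K, inferInstance, inferInstance, inferInstance, ι.comp (inlIsometry _ _), U₁,
    U₂ * star Q', Q', ?_, pow_mul_pow_eq_compression_of_lift (V₂ := W) ι h₁ (fun z => ?_) hU₁
      fun z => ?_, fun x => hQ' (inlIsometry _ _ x)⟩
  · have : U₁ * (U₂ * star Q') = U₂ * star Q' * Q' * U₁ := by
      rw [← mul_assoc, hU, mul_assoc, mul_assoc U₂ (star Q'), Unitary.mul_star_self,
        Unitary.star_mul_self, mul_one, mul_one]
    exact congrArg Subtype.val this
  · rw [h₂, mul_apply_eq_comp]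
    exact congrArg T₂ (unitary_apply_star_apply q z.fst)
  · change U₂.1 ((star Q').1 (ι z)) = _
    rw [hQs, hU₂]

/-- Adjoints give `T₂† T₁† = T₁† T₂† Q†`, the right-hand form for the swapped pair. Compressions
survive taking adjoints back, and the swap restores the order of the powers. -/
theorem hasQCommutingDilation_left (hQ : Q ∈ unitary (H →L[ℂ] H))
    (hT₁ : ‖T₁‖ ≤ 1) (hT₂ : ‖T₂‖ ≤ 1) (h : T₁ * T₂ = Q * T₂ * T₁) :
    HasQCommutingDilation .left Q T₁ T₂ := by
  obtain ⟨K, _, _, _, J, U₁, U₂, Q', hU, hpow, hQ'⟩ :=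
    hasQCommutingDilation_right (Q := star Q) (T₁ := star T₂) (T₂ := star T₁)
      (Unitary.star_mem hQ) (by rwa [norm_star]) (by rwa [norm_star])
      (by simpa [mul_assoc] using congrArg star h)
  refine ⟨K, inferInstance, inferInstance, inferInstance, J, star U₂, star U₁, star Q', ?_, ?_, ?_⟩
  · have hU' : (U₁ : K →L[ℂ] K) * U₂ = U₂ * U₁ * Q' := hU
    change star (U₂ : K →L[ℂ] K) * star (U₁ : K →L[ℂ] K) =
      star (Q' : K →L[ℂ] K) * star (U₁ : K →L[ℂ] K) * star (U₂ : K →L[ℂ] K)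
    simpa [mul_assoc] using congrArg star hU'
  · intro k₁ k₂
    have := congrArg adjoint (hpow k₂ k₁)
    rw [adjoint_comp, adjoint_comp, adjoint_adjoint] at this
    simpa [← star_eq_adjoint, comp_assoc] using this
  · intro x
    have := star_unitary_intertwines (Q := ⟨star Q, Unitary.star_mem hQ⟩) hQ' x
    simpa using this

end Dilation

end

theorem mainTheorem3 {H : Type u} [NormedAddCommGroup H] [InnerProductSpace ℂ H]
    [CompleteSpace H] (Q T₁ T₂ : H →L[ℂ] H) (hQ : Q ∈ unitary (H →L[ℂ] H))
    (hT₁ : ‖T₁‖ ≤ 1) (hT₂ : ‖T₂‖ ≤ 1) (r : QRelation) (hr : r.Holds Q T₁ T₂) :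
    ∃ (K : Type u) (_ : NormedAddCommGroup K) (_ : InnerProductSpace ℂ K)
      (_ : CompleteSpace K) (J : H →ₗᵢ[ℂ] K) (U₁ U₂ Q' : K →L[ℂ] K),
      U₁ ∈ unitary (K →L[ℂ] K) ∧ U₂ ∈ unitary (K →L[ℂ] K) ∧ Q' ∈ unitary (K →L[ℂ] K) ∧
      r.Holds Q' U₁ U₂ ∧
      (∀ (k₁ k₂ : ℕ) (h : H),
        J ((T₁ ^ k₁ * T₂ ^ k₂) h) =
          J.range.starProjection ((U₁ ^ k₁ * U₂ ^ k₂) (J h))) ∧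
      IsReducingSubspace J.range Q' ∧
      ∀ h : H, Q' (J h) = J (Q h) := by
  have hdil : HasQCommutingDilation r Q T₁ T₂ := by
    cases r with
    | left => exact hasQCommutingDilation_left hQ hT₁ hT₂ hr
    | middle => exact hasQCommutingDilation_middle hQ hT₁ hT₂ hr
    | right => exact hasQCommutingDilation_right hQ hT₁ hT₂ hr
  obtain ⟨K, _, _, _, J, U₁, U₂, Q', hU, hpow, hQ'⟩ := hdil
  refine ⟨K, inferInstance, inferInstance, inferInstance, J, U₁, U₂, Q', U₁.2, U₂.2, Q'.2, hU,
    fun k₁ k₂ h => ?_, ⟨?_, ?_⟩, hQ'⟩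
  · rw [J.starProjection_range_apply, hpow]
    rfl
  · rintro _ ⟨x, rfl⟩
    exact ⟨Q x, (hQ' x).symm⟩
  · rintro _ ⟨x, rfl⟩
    exact ⟨star Q x, (star_unitary_intertwines (Q := ⟨Q, hQ⟩) hQ' x).symm⟩
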